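/- Let $k$ be any field (of arbitrary characteristic, not necessarily algebraically closed). Then the ring $k[X,Y,Z,T]/(X + X^2Y + Z^2 + T^3)$ is not isomorphic, as a ring, to the polynomial ring in three variables over $k$. In particular, it is not isomorphic to it as a $k$-algebra. -/

import Mathlib

/-- The polynomial `X + X²Y + Z² + T³` in `k[X, Y, Z, T]`; the variables `X, Y, Z, T` are indexed
by `0, 1, 2, 3`. -/
noncomputable def russellPoly (k : Type*) [Field k] : MvPolynomial (Fin 4) k :=
  MvPolynomial.X 0 + MvPolynomial.X 0 ^ 2 * MvPolynomial.X 1 + MvPolynomial.X 2 ^ 2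
    + MvPolynomial.X 3 ^ 3

/-- The ring `k[X, Y, Z, T] / (X + X²Y + Z² + T³)`, with its natural `k`-algebra structure. -/
abbrev RussellRing (k : Type*) [Field k] : Type _ :=
  MvPolynomial (Fin 4) k ⧸ Ideal.span {russellPoly k}

section Endgame

open Polynomial

theorem Polynomial.natDegree_eq_zero_of_dvd_of_natDegree_eq_zero {S : Type*} [CommRing S]
    [IsDomain S] {P Q : S[X]} (h : P ∣ Q) (hQ : Q ≠ 0) (hd : Q.natDegree = 0) :
    P.natDegree = 0 :=
  Nat.le_zero.1 (hd ▸ natDegree_le_of_dvd h hQ)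

theorem Polynomial.natDegree_eq_zero_of_pow {S : Type*} [CommRing S] [IsDomain S] {P : S[X]}
    {n : ℕ} (hn : n ≠ 0) (h : (P ^ n).natDegree = 0) : P.natDegree = 0 := by
  rw [natDegree_pow] at h
  exact (Nat.mul_eq_zero.1 h).resolve_left hn

/-- Away from characteristic `2` and `3`, the curve `α P² + β Q³ = γ` with `α β γ ≠ 0` has no
nonconstant polynomial parametrization. -/
theorem Polynomial.natDegree_eq_zero_of_sq_add_cube {S : Type*} [CommRing S] [IsDomain S]
    (h2 : (2 : S) ≠ 0) (h3 : (3 : S) ≠ 0) {α β γ : S} (hα : α ≠ 0) (hβ : β ≠ 0) (hγ : γ ≠ 0)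
    {P Q : S[X]} (hP : P ≠ 0) (hQ : Q ≠ 0) (h : C α * P ^ 2 + C β * Q ^ 3 = C γ) :
    P.natDegree = 0 ∧ Q.natDegree = 0 := by
  classical
  set f := algebraMap S (FractionRing S) with hf
  have hinj : Function.Injective f := IsFractionRing.injective S (FractionRing S)
  have hne : ∀ {a : S}, a ≠ 0 → f a ≠ 0 := fun ha h0 => ha (hinj (by simpa using h0))
  have hmap : C (f α) * (P.map f) ^ 2 + C (f β) * (Q.map f) ^ 3 = C (f γ) := by
    simpa using congrArg (Polynomial.map f) h
  have h2' : (2 : FractionRing S) ≠ 0 := by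
    have := hne h2
    rwa [map_ofNat] at this
  have h3' : (3 : FractionRing S) ≠ 0 := by
    have := hne h3
    rwa [map_ofNat] at this
  have hcop : IsCoprime (P.map f) (Q.map f) := by
    refine ⟨C ((f γ)⁻¹ * f α) * P.map f, C ((f γ)⁻¹ * f β) * (Q.map f) ^ 2, ?_⟩
    have : C ((f γ)⁻¹) * C (f γ) = 1 := by rw [← C_mul, inv_mul_cancel₀ (hne hγ), C_1]
    rw [← this, ← hmap]
    simp only [C_mul]
    ring
  have key := Polynomial.flt_catalan (p := 2) (q := 3) (r := 6) (by norm_num) (by norm_num)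
    (by norm_num) (by norm_num) (by exact_mod_cast h2') (by exact_mod_cast h3')
    (by
      have : ((6 : ℕ) : FractionRing S) = 2 * 3 := by norm_num
      rw [this]
      exact mul_ne_zero h2' h3')
    ((Polynomial.map_ne_zero_iff hinj).2 hP) ((Polynomial.map_ne_zero_iff hinj).2 hQ)
    (one_ne_zero) hcop (hne hα) (hne hβ) (neg_ne_zero.2 (hne hγ))
    (by rw [hmap]; simp)
  rw [natDegree_map_eq_of_injective hinj, natDegree_map_eq_of_injective hinj] at key
  exact ⟨key.1, key.2.1⟩

/-- Every derivation of `S` extends to `S[X]`, coefficientwise. -/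
theorem Polynomial.exists_coeffwise_derivation {K S : Type*} [CommRing K] [CommRing S]
    [Algebra K S] (D : Derivation K S S) :
    ∃ E : Derivation K S[X] S[X], (∀ s, E (C s) = C (D s)) ∧ E X = 0 := by
  refine ⟨(PolynomialModule.equivPolynomialSelf (R := S)).toLinearMap.compDer D.mapCoeffs,
    fun s => ?_, ?_⟩
  · simp
  · simp

section Rigid

section Dvd

variable {K A : Type*} [CommRing K] [CommRing A] [Algebra K A] (D : Derivation K A A)

theorem dvd_sq_of_derivation [IsDomain A] {Z T z t l : A} (h2 : (2 : A) = 0) (hl : l ≠ 0)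
    (hDz : D z = 0) (hDt : D t = 1) (hDl : D l = 0)
    (h : Z ^ 2 - l * T ^ 3 = z ^ 2 - l * t ^ 3) : T ∣ t ^ 2 := by
  have hD := congrArg D h
  simp only [map_sub, Derivation.leibniz, Derivation.leibniz_pow, hDz, hDt, hDl,
    smul_eq_mul, nsmul_eq_mul, Nat.cast_ofNat] at hD
  refine Dvd.intro (T * D T) (mul_left_cancel₀ hl ?_)
  linear_combination -hD + (Z * D Z + l * t ^ 2 - l * T ^ 2 * D T) * h2

theorem dvd_two_mul_of_derivation {Z T z t l : A} (h3 : (3 : A) = 0)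
    (hDz : D z = 1) (hDl : D l = 0)
    (h : Z ^ 2 - l * T ^ 3 = z ^ 2 - l * t ^ 3) : Z ∣ 2 * z := by
  have hD := congrArg D h
  simp only [map_sub, Derivation.leibniz, Derivation.leibniz_pow, hDz, hDl,
    smul_eq_mul, nsmul_eq_mul, Nat.cast_ofNat] at hD
  refine Dvd.intro (2 * D Z) ?_
  linear_combination hD + (l * T ^ 2 * D T - l * t ^ 2 * D t) * h3

theorem sq_dvd_of_derivation {P T z t : A} (h2 : (2 : A) = 0)
    (hDz : D z = 0) (hDt : D t = 1)
    (h : P ^ 2 * (z ^ 2 + t ^ 3) - T ^ 3 = z ^ 2) : T ^ 2 ∣ t ^ 2 * z ^ 2 := by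
  have hD := congrArg D h
  simp only [map_sub, map_add, Derivation.leibniz, Derivation.leibniz_pow, hDz, hDt,
    smul_eq_mul, nsmul_eq_mul, Nat.cast_ofNat] at hD
  refine Dvd.intro (D T * (z ^ 2 + t ^ 3) - t ^ 2 * T) ?_
  linear_combination t ^ 2 * h - (z ^ 2 + t ^ 3) * hD +
    (z ^ 2 + t ^ 3) * ((z ^ 2 + t ^ 3) * P * D P + P ^ 2 * t ^ 2 - T ^ 2 * D T) * h2

theorem dvd_of_derivation {P T y z : A} (h3 : (3 : A) = 0) (hDz : D z = 1)
    (h : P ^ 2 * y - T ^ 3 = z ^ 2) : P ∣ 2 * z := by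
  have hD := congrArg D h
  simp only [map_sub, Derivation.leibniz, Derivation.leibniz_pow, hDz,
    smul_eq_mul, nsmul_eq_mul, Nat.cast_ofNat] at hD
  refine Dvd.intro (P * D y + 2 * y * D P) ?_
  linear_combination hD + (T ^ 2 * D T) * h3

end Dvd

/-- Elements `z`, `t` of a domain over `K` that behave like two independent variables. -/
structure IsGenericPair (K : Type*) {S : Type*} [Field K] [CommRing S] [Algebra K S] (z t : S) :
    Prop where
  exists_derivation_fst : ∃ D : Derivation K S S, D z = 1 ∧ D t = 0
  exists_derivation_snd : ∃ D : Derivation K S S, D z = 0 ∧ D t = 1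
  sub_ne_zero : ∀ l : K, l ≠ 0 → z ^ 2 - algebraMap K S l * t ^ 3 ≠ 0
  sq_mul_ne_sq : ∀ a b : S, a ≠ 0 → a ^ 2 * (z ^ 2 + t ^ 3) ≠ b ^ 2
  linearIndependent : LinearIndependent K fun m : ℕ × ℕ => z ^ m.1 * t ^ m.2

variable {K S : Type*} [Field K] [CommRing S] [Algebra K S] {z t : S}

namespace IsGenericPair

theorem fst_ne_zero [Nontrivial S] (hzt : IsGenericPair K z t) : z ≠ 0 := by
  rintro rfl
  obtain ⟨D, h, -⟩ := hzt.exists_derivation_fst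
  simp at h

theorem snd_ne_zero [Nontrivial S] (hzt : IsGenericPair K z t) : t ≠ 0 := by
  rintro rfl
  obtain ⟨D, -, h⟩ := hzt.exists_derivation_snd
  simp at h

theorem add_ne_zero (hzt : IsGenericPair K z t) : z ^ 2 + t ^ 3 ≠ 0 := by
  simpa using hzt.sub_ne_zero (-1 : K) (by simp)

end IsGenericPair

theorem natCast_eq_zero_iff_of_algebra (A : Type*) [CommRing A] [Nontrivial A] [Algebra K A]
    (n : ℕ) : (n : A) = 0 ↔ (n : K) = 0 := by
  rw [← map_natCast (algebraMap K A), map_eq_zero_iff _ (FaithfulSMul.algebraMap_injective K A)]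

variable [IsDomain S]

theorem ne_zero_of_coeff_zero_ne_zero {S : Type*} [CommRing S] {P : S[X]} (h : P.coeff 0 ≠ 0) :
    P ≠ 0 := by
  rintro rfl
  simp at h

theorem eq_C_of_natDegree {S : Type*} [CommRing S] {P : S[X]} {c : S} (h : P.natDegree = 0)
    (h0 : P.coeff 0 = c) : P = C c := by
  rw [eq_C_of_natDegree_eq_zero h, h0]

theorem natDegree_eq_zero_of_C_mul_pow {S : Type*} [CommRing S] [IsDomain S] {P : S[X]} {a b : S}
    {n : ℕ} (hn : n ≠ 0) (ha : a ≠ 0) (h : C a * P ^ n = C b) : P.natDegree = 0 := by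
  apply natDegree_eq_zero_of_pow hn
  rw [← natDegree_C_mul ha, h, natDegree_C]

/-- If `Z² - l T³` does not depend on `U`, neither do `Z` and `T`. -/
theorem natDegree_eq_zero_of_sq_sub_cube (hzt : IsGenericPair K z t) {Z T : S[X]} (hZ : Z.coeff 0 = z)
    (hT : T.coeff 0 = t) {l : K} (hl : l ≠ 0)
    (h : (Z ^ 2 - C (algebraMap K S l) * T ^ 3).natDegree = 0) : Z.natDegree = 0 ∧ T.natDegree = 0 := by
  have heq : Z ^ 2 - C (algebraMap K S l) * T ^ 3 = C (z ^ 2 - algebraMap K S l * t ^ 3) :=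
    eq_C_of_natDegree h (by simp [coeff_zero_eq_eval_zero] at hZ hT ⊢; simp [hZ, hT])
  have heq' : Z ^ 2 - C (algebraMap K S l) * T ^ 3 = C z ^ 2 - C (algebraMap K S l) * C t ^ 3 := by
    rw [heq]; simp
  have hZ0 : Z ≠ 0 := ne_zero_of_coeff_zero_ne_zero (by simp [hZ, hzt.fst_ne_zero])
  have hT0 : T ≠ 0 := ne_zero_of_coeff_zero_ne_zero (by simp [hT, hzt.snd_ne_zero])
  have hCl : (algebraMap K S l : S) ≠ 0 := by simpa using hl
  have ZT : Z.natDegree = 0 → T.natDegree = 0 := by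
    intro hd
    obtain ⟨c, rfl⟩ := natDegree_eq_zero.1 hd
    refine natDegree_eq_zero_of_C_mul_pow (b := c ^ 2 - (z ^ 2 - algebraMap K S l * t ^ 3))
      three_ne_zero hCl ?_
    rw [C_sub, ← heq, C_pow]; ring
  have TZ : T.natDegree = 0 → Z.natDegree = 0 := by
    intro hd
    obtain ⟨c, rfl⟩ := natDegree_eq_zero.1 hd
    refine natDegree_eq_zero_of_C_mul_pow
      (b := algebraMap K S l * c ^ 3 + (z ^ 2 - algebraMap K S l * t ^ 3)) two_ne_zero one_ne_zero ?_
    rw [C_add, ← heq, C_mul, C_pow, C_1]; ring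
  by_cases h2 : ((2 : ℕ) : K) = 0
  · obtain ⟨D₀, hz₀, ht₀⟩ := hzt.exists_derivation_snd
    obtain ⟨D, hD⟩ := exists_coeffwise_derivation D₀
    have hdvd := dvd_sq_of_derivation D ((natCast_eq_zero_iff_of_algebra _ 2).2 h2)
      (by simpa using hl) (by simp [hD, hz₀]) (by simp [hD, ht₀]) (by simp [hD]) heq'
    have hT' : T.natDegree = 0 :=
      natDegree_eq_zero_of_dvd_of_natDegree_eq_zero hdvd
      (by simp [hzt.snd_ne_zero]) (by rw [← C_pow, natDegree_C])
    exact ⟨TZ hT', hT'⟩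
  by_cases h3 : ((3 : ℕ) : K) = 0
  · obtain ⟨D₀, hz₀, -⟩ := hzt.exists_derivation_fst
    obtain ⟨D, hD⟩ := exists_coeffwise_derivation D₀
    have hdvd := dvd_two_mul_of_derivation D ((natCast_eq_zero_iff_of_algebra _ 3).2 h3)
      (by simp [hD, hz₀]) (by simp [hD]) heq'
    have h2' : (2 : S) ≠ 0 := fun h => h2 ((natCast_eq_zero_iff_of_algebra S 2).1 h)
    have hZ' : Z.natDegree = 0 := by
      refine natDegree_eq_zero_of_dvd_of_natDegree_eq_zero hdvd ?_ ?_
      · rw [← C_ofNat, ← C_mul]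
        simp [h2', hzt.fst_ne_zero]
      · rw [← C_ofNat, ← C_mul, natDegree_C]
    exact ⟨hZ', ZT hZ'⟩
  · refine natDegree_eq_zero_of_sq_add_cube (α := 1) (β := -algebraMap K S l)
      (γ := z ^ 2 - algebraMap K S l * t ^ 3) ?_ ?_ one_ne_zero (by simpa using hl)
      (hzt.sub_ne_zero l hl) hZ0 hT0 (by rw [← heq]; simp; ring)
    · exact fun h => h2 ((natCast_eq_zero_iff_of_algebra S 2).1 h)
    · exact fun h => h3 ((natCast_eq_zero_iff_of_algebra S 3).1 h)

/-- The twisted cubic surface relation over `K[z][t]`, when `Z` does not depend on `U`. -/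
theorem natDegree_eq_zero_of_sq_mul_sub_cube (hzt : IsGenericPair K z t) {P T : S[X]} (hP : P.coeff 0 = 1)
    (hT : T.coeff 0 = t)
    (h : P ^ 2 * C (z ^ 2 + t ^ 3) - T ^ 3 = C (z ^ 2)) :
    P.natDegree = 0 ∧ T.natDegree = 0 := by
  have hq := hzt.add_ne_zero
  have hP0 : P ≠ 0 := ne_zero_of_coeff_zero_ne_zero (by simp [hP])
  have hT0 : T ≠ 0 := ne_zero_of_coeff_zero_ne_zero (by simp [hT, hzt.snd_ne_zero])
  have h' : P ^ 2 * (C z ^ 2 + C t ^ 3) - T ^ 3 = C z ^ 2 := by simpa using h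
  have PT : P.natDegree = 0 → T.natDegree = 0 := by
    intro hd
    obtain ⟨c, rfl⟩ := natDegree_eq_zero.1 hd
    refine natDegree_eq_zero_of_C_mul_pow (b := c ^ 2 * (z ^ 2 + t ^ 3) - z ^ 2)
      three_ne_zero one_ne_zero ?_
    rw [C_sub, ← h, C_mul, C_pow, C_1]; ring
  have TP : T.natDegree = 0 → P.natDegree = 0 := by
    intro hd
    obtain ⟨c, rfl⟩ := natDegree_eq_zero.1 hd
    refine natDegree_eq_zero_of_C_mul_pow (b := c ^ 3 + z ^ 2) two_ne_zero hq ?_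
    simp only [C_add, C_pow] at h ⊢
    linear_combination h
  by_cases h2 : ((2 : ℕ) : K) = 0
  · obtain ⟨D₀, hz₀, ht₀⟩ := hzt.exists_derivation_snd
    obtain ⟨D, hD⟩ := exists_coeffwise_derivation D₀
    have hdvd := sq_dvd_of_derivation D ((natCast_eq_zero_iff_of_algebra _ 2).2 h2) (by simp [hD, hz₀])
      (by simp [hD, ht₀]) h'
    have hT' : T.natDegree = 0 := by
      refine natDegree_eq_zero_of_pow two_ne_zero
        (natDegree_eq_zero_of_dvd_of_natDegree_eq_zero hdvd
        (by simp [hzt.fst_ne_zero, hzt.snd_ne_zero]) ?_)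
      rw [← C_pow, ← C_pow, ← C_mul, natDegree_C]
    exact ⟨TP hT', hT'⟩
  by_cases h3 : ((3 : ℕ) : K) = 0
  · obtain ⟨D₀, hz₀, -⟩ := hzt.exists_derivation_fst
    obtain ⟨D, hD⟩ := exists_coeffwise_derivation D₀
    have hdvd := dvd_of_derivation D ((natCast_eq_zero_iff_of_algebra _ 3).2 h3) (by simp [hD, hz₀]) h'
    have h2' : (2 : S) ≠ 0 := fun h => h2 ((natCast_eq_zero_iff_of_algebra S 2).1 h)
    have hP' : P.natDegree = 0 := by
      refine natDegree_eq_zero_of_dvd_of_natDegree_eq_zero hdvd ?_ ?_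
      · rw [← C_ofNat, ← C_mul]
        simp [h2', hzt.fst_ne_zero]
      · rw [← C_ofNat, ← C_mul, natDegree_C]
    exact ⟨hP', PT hP'⟩
  · refine natDegree_eq_zero_of_sq_add_cube (α := z ^ 2 + t ^ 3) (β := -1)
      (γ := z ^ 2) ?_ ?_ hq (by simp)
      (by simp [hzt.fst_ne_zero]) hP0 hT0 (by rw [← h]; simp; ring)
    · exact fun h => h2 ((natCast_eq_zero_iff_of_algebra S 2).1 h)
    · exact fun h => h3 ((natCast_eq_zero_iff_of_algebra S 3).1 h)

theorem natDegree_eq_zero_of_sq_mul_sub_sq (hzt : IsGenericPair K z t) {P Z : S[X]} {c : S}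
    (h : P ^ 2 * C (z ^ 2 + t ^ 3) - Z ^ 2 = C c) : P.natDegree = 0 ∧ Z.natDegree = 0 := by
  have hq := hzt.add_ne_zero
  have hPZ : P.natDegree = Z.natDegree := by
    by_contra hne
    have hd : (P ^ 2 * C (z ^ 2 + t ^ 3)).natDegree ≠ (Z ^ 2).natDegree := by
      rw [natDegree_mul_C hq, natDegree_pow, natDegree_pow]
      omega
    have h1 : (P ^ 2 * C (z ^ 2 + t ^ 3) - Z ^ 2).natDegree = 0 := by rw [h, natDegree_C]
    rcases lt_or_gt_of_ne hd with hd | hd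
    · rw [natDegree_sub_eq_right_of_natDegree_lt hd] at h1
      omega
    · rw [natDegree_sub_eq_left_of_natDegree_lt hd] at h1
      omega
  by_contra hcon
  have hn : P.natDegree ≠ 0 := fun h0 => hcon ⟨h0, hPZ ▸ h0⟩
  have hc := congrArg (fun F : S[X] => F.coeff (2 * P.natDegree)) h
  simp only [coeff_sub, coeff_mul_C] at hc
  have e1 : (P ^ 2).coeff (2 * P.natDegree) = P.leadingCoeff ^ 2 := by
    rw [coeff_pow_mul_natDegree]
  have e2 : (Z ^ 2).coeff (2 * P.natDegree) = Z.leadingCoeff ^ 2 := by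
    rw [hPZ, coeff_pow_mul_natDegree]
  rw [e1, e2, coeff_C_of_ne_zero (by omega), sub_eq_zero] at hc
  refine hzt.sq_mul_ne_sq _ _ (leadingCoeff_ne_zero.2 ?_) hc
  rintro rfl
  simp at hn

/-- Rigidity of `P² Y + Z² + T³ = 0` when `Y` and one further element are invariant. -/
theorem natDegree_eq_zero_of_relation (hzt : IsGenericPair K z t) {P Y Z T : S[X]}
    (h : P ^ 2 * Y + Z ^ 2 + T ^ 3 = 0)
    (hP : P.coeff 0 = 1) (hYc : Y.coeff 0 = -(z ^ 2 + t ^ 3)) (hZ : Z.coeff 0 = z)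
    (hT : T.coeff 0 = t) (hY : Y.natDegree = 0)
    (hcase : P.natDegree = 0 ∨ Z.natDegree = 0 ∨ T.natDegree = 0 ∨
      ∃ l : K, l ≠ 0 ∧ (Z ^ 2 - C (algebraMap K S l) * T ^ 3).natDegree = 0) :
    P.natDegree = 0 ∧ Z.natDegree = 0 ∧ T.natDegree = 0 := by
  have hq := hzt.add_ne_zero
  have hY' := eq_C_of_natDegree hY hYc
  have key : ∀ l : K, l ≠ 0 → (Z ^ 2 - C (algebraMap K S l) * T ^ 3).natDegree = 0 →
      P.natDegree = 0 ∧ Z.natDegree = 0 ∧ T.natDegree = 0 := by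
    intro l hl hd
    obtain ⟨h1, h2⟩ := natDegree_eq_zero_of_sq_sub_cube hzt hZ hT hl hd
    refine ⟨?_, h1, h2⟩
    obtain ⟨c, rfl⟩ := natDegree_eq_zero.1 h1
    obtain ⟨d, rfl⟩ := natDegree_eq_zero.1 h2
    refine natDegree_eq_zero_of_C_mul_pow (b := c ^ 2 + d ^ 3) two_ne_zero hq ?_
    rw [hY', C_neg] at h
    simp only [C_add, C_pow] at h ⊢
    linear_combination -h
  rw [hY', C_neg] at h
  rcases hcase with hd | hd | hd | ⟨l, hl, hd⟩
  · refine key (-1) (by simp) ?_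
    have hP1 := eq_C_of_natDegree hd hP
    rw [hP1] at h
    have : Z ^ 2 - C (algebraMap K S (-1)) * T ^ 3 = C (z ^ 2 + t ^ 3) := by
      simp only [map_neg, map_one] at h ⊢
      linear_combination h
    rw [this, natDegree_C]
  · have hZ1 := eq_C_of_natDegree hd hZ
    have := natDegree_eq_zero_of_sq_mul_sub_cube hzt hP hT (by
      rw [hZ1] at h
      rw [C_pow]
      linear_combination -h)
    exact ⟨this.1, hd, this.2⟩
  · have hT1 := eq_C_of_natDegree hd hT
    have := natDegree_eq_zero_of_sq_mul_sub_sq hzt (P := P) (Z := Z) (c := t ^ 3) (by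
      rw [hT1] at h
      rw [C_pow]
      linear_combination -h)
    exact ⟨this.1, this.2, hd⟩
  · exact key l hl hd

theorem isGenericPair_C_X_X (K : Type*) [Field K] :
    IsGenericPair K (C X : K[X][X]) (X : K[X][X]) where
  exists_derivation_fst := by
    obtain ⟨D, h, h'⟩ := exists_coeffwise_derivation (derivative' (R := K))
    exact ⟨D, by simp [h], h'⟩
  exists_derivation_snd :=
    ⟨(derivative' (R := K[X])).restrictScalars K, by simp, by simp⟩
  sub_ne_zero l hl h := by
    have := congrArg (fun p : K[X][X] => (p.coeff 3).coeff 0) h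
    have h0 : ((C X ^ 2 : K[X][X]).coeff 3) = 0 := by rw [← C_pow, coeff_C]; simp
    simp only [coeff_sub, h0, Polynomial.algebraMap_apply, algebraMap_eq, coeff_C_mul, coeff_X_pow] at this
    simp at this
    exact hl this
  sq_mul_ne_sq a b ha h := by
    have hd : (C X ^ 2 + X ^ 3 : K[X][X]).natDegree = 3 := by
      rw [← C_pow]
      compute_degree!
    have hq : (C X ^ 2 + X ^ 3 : K[X][X]) ≠ 0 := by
      intro h0
      simp [h0] at hd
    have := congrArg natDegree h
    rw [natDegree_mul (pow_ne_zero 2 ha) hq, natDegree_pow, natDegree_pow, hd] at this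
    omega
  linearIndependent := by
    rw [linearIndependent_iff']
    intro s c hc i hi
    have := congrArg (fun p : K[X][X] => (p.coeff i.2).coeff i.1) hc
    simp only [finsetSum_coeff, coeff_smul, ← C_pow, coeff_C_mul, coeff_X_pow, coeff_zero] at this
    rw [Finset.sum_eq_single i] at this
    · simpa using this
    · intro j _ hj
      by_cases h2 : i.2 = j.2
      · have h1 : i.1 ≠ j.1 := fun h1 => hj (Prod.ext h1.symm h2.symm)
        simp [h2, coeff_X_pow, h1]
      · simp [h2]
    · exact fun h => absurd hi h

end Rigid

end Endgame

section Top

set_option linter.unusedSectionVars false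

open AddMonoidAlgebra (single)

/-- All exponents occurring in `H` are at most `n`, and `a` is the coefficient at `n`. -/
def AddMonoidAlgebra.HasTop {A Γ : Type*} [Semiring A] [LT Γ] (H : AddMonoidAlgebra A Γ)
    (n : Γ) (a : A) : Prop :=
  (∀ e, n < e → H.coeff e = 0) ∧ H.coeff n = a

namespace AddMonoidAlgebra.HasTop

variable {A Γ : Type*} [CommRing A] [AddCommGroup Γ] [LinearOrder Γ] [IsOrderedAddMonoid Γ]
  {H H' : AddMonoidAlgebra A Γ} {n m : Γ} {a b : A}

theorem of_lt (h : H.HasTop n a) (hnm : n < m) : H.HasTop m 0 :=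
  ⟨fun e he => h.1 e (hnm.trans he), h.1 m hnm⟩

theorem zero : (0 : AddMonoidAlgebra A Γ).HasTop n 0 := ⟨fun _ _ => rfl, rfl⟩

theorem add (h : H.HasTop n a) (h' : H'.HasTop n b) : (H + H').HasTop n (a + b) :=
  ⟨fun e he => by simp [h.1 e he, h'.1 e he], by simp [h.2, h'.2]⟩

theorem single : (single n a : AddMonoidAlgebra A Γ).HasTop n a :=
  ⟨fun e he => by simp [he.ne], by simp⟩

theorem one : (1 : AddMonoidAlgebra A Γ).HasTop 0 1 := single

theorem mul (h : H.HasTop n a) (h' : H'.HasTop m b) : (H * H').HasTop (n + m) (a * b) := by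
  constructor
  · intro e he
    rw [coeff_mul]
    refine Finset.sum_eq_zero fun i _ => Finset.sum_eq_zero fun j _ => ?_
    rw [ite_eq_right_iff]
    intro hij
    rcases lt_or_ge n i with hi | hi
    · rw [h.1 i hi, zero_mul]
    · rw [h'.1 j, mul_zero]
      by_contra! hj
      exact absurd (add_le_add hi hj) (not_le.2 (hij ▸ he))
  · rw [coeff_mul, Finsupp.sum, Finset.sum_eq_single n, Finsupp.sum, Finset.sum_eq_single m]
    · simp [h.2, h'.2]
    · intro j _ hj
      rw [if_neg (by simpa using hj)]
    · intro hm
      simp [Finsupp.notMem_support_iff.1 hm]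
    · intro i _ hi
      refine Finset.sum_eq_zero fun j _ => ?_
      rw [ite_eq_right_iff]
      intro hij
      rcases lt_or_gt_of_ne hi with hi | hi
      · rw [h'.1 j, mul_zero]
        by_contra! hj
        exact absurd hij (add_lt_add_of_lt_of_le hi hj).ne
      · rw [h.1 i hi, zero_mul]
    · intro hn
      refine Finset.sum_eq_zero fun j _ => ?_
      simp [Finsupp.notMem_support_iff.1 hn]

theorem pow (h : H.HasTop n a) (k : ℕ) : (H ^ k).HasTop (k • n) (a ^ k) := by
  induction k with
  | zero => simpa using one
  | succ k ih => rw [pow_succ, pow_succ, succ_nsmul]; exact ih.mul h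

theorem sum {ι : Type*} {s : Finset ι} {H : ι → AddMonoidAlgebra A Γ} {a : ι → A}
    (h : ∀ i ∈ s, (H i).HasTop n (a i)) : (∑ i ∈ s, H i).HasTop n (∑ i ∈ s, a i) := by
  classical
  induction s using Finset.induction_on with
  | empty => simpa using zero
  | insert i s hi ih =>
    rw [Finset.sum_insert hi, Finset.sum_insert hi]
    exact (h i (by simp)).add (ih fun j hj => h j (by simp [hj]))

theorem prod {ι : Type*} {s : Finset ι} {H : ι → AddMonoidAlgebra A Γ} {a : ι → A} {n : ι → Γ}
    (h : ∀ i ∈ s, (H i).HasTop (n i) (a i)) :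
    (∏ i ∈ s, H i).HasTop (∑ i ∈ s, n i) (∏ i ∈ s, a i) := by
  classical
  induction s using Finset.induction_on with
  | empty => simpa using one
  | insert i s hi ih =>
    rw [Finset.sum_insert hi, Finset.prod_insert hi, Finset.prod_insert hi]
    exact (h i (by simp)).mul (ih fun j hj => h j (by simp [hj]))

/-- The top part of the image of a polynomial all of whose monomials have weight at most `n`. -/
theorem map_mvPolynomial {σ k : Type*} [Fintype σ] [CommRing k]
    (Ψ : MvPolynomial σ k →+* AddMonoidAlgebra A Γ) {κ : k → A} {w : σ → Γ} {g : σ → A}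
    (hC : ∀ c, (Ψ (MvPolynomial.C c)).HasTop 0 (κ c))
    (hX : ∀ i, (Ψ (MvPolynomial.X i)).HasTop (w i) (g i))
    {F : MvPolynomial σ k} (hF : ∀ m ∈ F.support, ∑ i, m i • w i ≤ n) :
    (Ψ F).HasTop n
      (∑ m ∈ F.support with ∑ i, m i • w i = n, κ (F.coeff m) * ∏ i, g i ^ m i) := by
  rw [F.as_sum, map_sum, ← F.as_sum, Finset.sum_filter]
  refine sum fun m hm => ?_
  have h : (Ψ (MvPolynomial.monomial m (F.coeff m))).HasTop (∑ i, m i • w i)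
      (κ (F.coeff m) * ∏ i, g i ^ m i) := by
    rw [MvPolynomial.monomial_eq, map_mul, Finsupp.prod_fintype _ _ (by simp), map_prod,
      ← zero_add (∑ i, m i • w i)]
    refine (hC _).mul (prod fun i _ => ?_)
    rw [map_pow]
    exact (hX i).pow _
  rcases (hF m hm).lt_or_eq with hlt | heq
  · rw [if_neg hlt.ne]
    exact h.of_lt hlt
  · rw [if_pos heq]
    exact heq ▸ h

theorem unique (h : H.HasTop n a) (h' : H.HasTop n b) : a = b := h.2.symm.trans h'.2

end AddMonoidAlgebra.HasTop

open Polynomial in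
/-- The homomorphism `S[ℚ][U] → S[U][ℚ]` giving the variable `U` the weight `ρ`. -/
noncomputable def weightTwist (S : Type*) [CommRing S] (ρ : ℚ) :
    (AddMonoidAlgebra S ℚ)[X] →+* AddMonoidAlgebra S[X] ℚ :=
  eval₂RingHom (AddMonoidAlgebra.mapRingHom ℚ C) (single ρ X)

open Polynomial in
theorem coeff_coeff_weightTwist {S : Type*} [CommRing S] (ρ e : ℚ)
    (H : (AddMonoidAlgebra S ℚ)[X]) (i : ℕ) :
    ((weightTwist S ρ H).coeff e).coeff i = (H.coeff i).coeff (e - i * ρ) := by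
  induction H using Polynomial.induction_on' with
  | add p q hp hq => simp [hp, hq]
  | monomial j h =>
    rw [weightTwist, coe_eval₂RingHom, eval₂_monomial, AddMonoidAlgebra.single_pow,
      AddMonoidAlgebra.coeff_mul_single_apply, AddMonoidAlgebra.coeff_mapRingHom, coeff_C_mul,
      coeff_X_pow, coeff_monomial]
    by_cases hij : i = j
    · subst hij
      simp [sub_eq_add_neg]
    · simp [hij, Ne.symm hij]

end Top

section Forms

open Polynomial

/-- A binary form of positive degree over an algebraically closed field has a linear factor. -/
theorem exists_dvd_form {K A : Type*} [Field K] [IsAlgClosed K] [CommRing A] [Algebra K A]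
    (f : K[X]) {L : ℕ} (hL : L ≠ 0) (hf : f.natDegree ≤ L) (a b : A) :
    b ∣ ∑ l ∈ Finset.range (L + 1), algebraMap K A (f.coeff l) * (a ^ l * b ^ (L - l)) ∨
    ∃ r : K, a - algebraMap K A r * b ∣
      ∑ l ∈ Finset.range (L + 1), algebraMap K A (f.coeff l) * (a ^ l * b ^ (L - l)) := by
  by_cases hd : f.natDegree = 0
  · left
    refine Finset.dvd_sum fun l hl => ?_
    by_cases h0 : l = 0
    · subst h0
      exact Dvd.dvd.mul_left (Dvd.dvd.mul_left (dvd_pow_self b (by omega)) _) _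
    · rw [coeff_eq_zero_of_natDegree_lt (by omega)]
      simp
  · right
    obtain ⟨r, hr⟩ := IsAlgClosed.exists_root f (fun h => hd (natDegree_eq_of_degree_eq_some h))
    refine ⟨r, ?_⟩
    have h0 : ∑ l ∈ Finset.range (L + 1),
        algebraMap K A (f.coeff l) * ((algebraMap K A r * b) ^ l * b ^ (L - l)) = 0 := by
      have := congrArg (fun c => algebraMap K A c * b ^ L) hr
      rw [eval_eq_sum_range' (Nat.lt_succ_of_le hf)] at this
      simp only [map_sum, map_mul, map_pow, map_zero, zero_mul, Finset.sum_mul] at this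
      rw [← this]
      refine Finset.sum_congr rfl fun l hl => ?_
      have : b ^ L = b ^ l * b ^ (L - l) := by
        rw [← pow_add, Nat.add_sub_cancel' (Nat.lt_succ_iff.1 (Finset.mem_range.1 hl))]
      rw [this]
      ring
    rw [← sub_zero (Finset.sum _ _), ← h0, ← Finset.sum_sub_distrib]
    refine Finset.dvd_sum fun l _ => ?_
    rw [← mul_sub, ← sub_mul]
    exact Dvd.dvd.mul_left (Dvd.dvd.mul_right (sub_dvd_pow_sub_pow _ _ l) _) _

/-- A weighted homogeneous polynomial in `Z`, `T` (of weights `3`, `2`). -/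
theorem exists_factor_of_weighted {ι K A : Type*} [Field K] [IsAlgClosed K] [CommRing A]
    [Algebra K A] (s : Finset ι) (c : ι → K) (p q : ι → ℕ) {M : ℕ} (hM : M ≠ 0)
    (hpq : ∀ i ∈ s, 3 * p i + 2 * q i = M) (Z T : A) :
    Z ∣ ∑ i ∈ s, algebraMap K A (c i) * (Z ^ p i * T ^ q i) ∨
    T ∣ ∑ i ∈ s, algebraMap K A (c i) * (Z ^ p i * T ^ q i) ∨
    ∃ r : K, r ≠ 0 ∧ Z ^ 2 - algebraMap K A r * T ^ 3 ∣
      ∑ i ∈ s, algebraMap K A (c i) * (Z ^ p i * T ^ q i) := by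
  classical
  by_cases hr : M % 2 = 0
  swap
  · left
    refine Finset.dvd_sum fun i hi => ?_
    have := hpq i hi
    exact Dvd.dvd.mul_left (Dvd.dvd.mul_right (dvd_pow_self Z (by omega)) _) _
  by_cases hq : (M / 2) % 3 = 0
  swap
  · right; left
    refine Finset.dvd_sum fun i hi => ?_
    have := hpq i hi
    exact Dvd.dvd.mul_left (Dvd.dvd.mul_left (dvd_pow_self T (by omega)) _) _
  set L := M / 6 with hLdef
  have hML : M = 6 * L := by omega
  have hL : L ≠ 0 := by omega
  set f : K[X] := ∑ i ∈ s, monomial (p i / 2) (c i) with hf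
  have hfd : f.natDegree ≤ L := by
    refine natDegree_sum_le_of_forall_le _ _ fun i hi => (natDegree_monomial_le _).trans ?_
    have := hpq i hi
    omega
  have hsum : ∑ l ∈ Finset.range (L + 1),
      algebraMap K A (f.coeff l) * ((Z ^ 2) ^ l * (T ^ 3) ^ (L - l)) =
      ∑ i ∈ s, algebraMap K A (c i) * (Z ^ p i * T ^ q i) := by
    simp only [hf, finsetSum_coeff, map_sum, Finset.sum_mul]
    rw [Finset.sum_comm]
    refine Finset.sum_congr rfl fun i hi => ?_
    have := hpq i hi
    rw [Finset.sum_eq_single (p i / 2)]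
    · rw [coeff_monomial, if_pos rfl, ← pow_mul, ← pow_mul]
      congr 3 <;> omega
    · intro l _ hl
      rw [coeff_monomial, if_neg (Ne.symm hl)]
      simp
    · intro h
      exact absurd (Finset.mem_range.2 (by omega)) h
  rcases exists_dvd_form f hL hfd (Z ^ 2) (T ^ 3) with h | ⟨r, h⟩
  · rw [hsum] at h
    exact Or.inr (Or.inl ((dvd_pow_self T three_ne_zero).trans h))
  · rw [hsum] at h
    by_cases hr0 : r = 0
    · subst hr0
      rw [map_zero, zero_mul, sub_zero] at h
      exact Or.inl ((dvd_pow_self Z two_ne_zero).trans h)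
    · exact Or.inr (Or.inr ⟨r, hr0, h⟩)

end Forms

section TopPart

open Polynomial

/-- Weights of the variables `X, Y, Z, T`. -/
def russellWeight (N : ℕ) : Fin 4 → ℚ := ![-N, 6 + 2 * N, 3, 2]

theorem sum_russellWeight (N : ℕ) (m : Fin 4 →₀ ℕ) :
    ∑ i, m i • russellWeight N i =
      N * (2 * m 1 - m 0) + (6 * m 1 + 3 * m 2 + 2 * m 3 : ℕ) := by
  simp [Fin.sum_univ_four, russellWeight]
  ring

/-- The monomials that form a basis modulo `X + X² Y + Z² + T³`. -/
def IsReducedMonomial (m : Fin 4 →₀ ℕ) : Prop := m 1 = 0 ∨ m 0 ≤ 1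

theorem eq_of_russellWeight_eq {N : ℕ} {m m' : Fin 4 →₀ ℕ} (hm : IsReducedMonomial m)
    (hm' : IsReducedMonomial m') (hN : 6 * m 1 + 3 * m 2 + 2 * m 3 < N)
    (hN' : 6 * m' 1 + 3 * m' 2 + 2 * m' 3 < N)
    (h : ∑ i, m i • russellWeight N i = ∑ i, m' i • russellWeight N i) :
    m 0 = m' 0 ∧ m 1 = m' 1 ∧ 3 * m 2 + 2 * m 3 = 3 * m' 2 + 2 * m' 3 := by
  rw [sum_russellWeight, sum_russellWeight] at h
  have hz : (N : ℤ) * (2 * m 1 - m 0) + (6 * m 1 + 3 * m 2 + 2 * m 3 : ℕ) =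
      N * (2 * m' 1 - m' 0) + (6 * m' 1 + 3 * m' 2 + 2 * m' 3 : ℕ) := by exact_mod_cast h
  have hD : ((2 * m 1 - m 0 : ℤ) - (2 * m' 1 - m' 0)) = 0 := by
    have hdvd : (N : ℤ) ∣ (6 * m' 1 + 3 * m' 2 + 2 * m' 3 : ℕ) -
        (6 * m 1 + 3 * m 2 + 2 * m 3 : ℕ) :=
      Dvd.intro ((2 * m 1 - m 0 : ℤ) - (2 * m' 1 - m' 0)) (by linear_combination hz)
    have h0 := Int.eq_zero_of_abs_lt_dvd hdvd (by rw [abs_lt]; omega)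
    have hmul : (N : ℤ) * ((2 * m 1 - m 0 : ℤ) - (2 * m' 1 - m' 0)) = 0 := by
      linear_combination hz + h0
    exact (mul_eq_zero.1 hmul).resolve_left (by omega)
  have hD' : (2 * m 1 - m 0 : ℤ) = 2 * m' 1 - m' 0 := by linarith
  rw [hD'] at hz
  unfold IsReducedMonomial at hm hm'
  omega

theorem russellWeight_lt {N : ℕ} {m m' : Fin 4 →₀ ℕ} (hm' : IsReducedMonomial m')
    (hN : 6 * m 1 + 3 * m 2 + 2 * m 3 < N) (h0 : m 1 = 0) (h1 : m' 1 ≠ 0) :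
    ∑ i, m i • russellWeight N i < ∑ i, m' i • russellWeight N i := by
  rw [sum_russellWeight, sum_russellWeight]
  have hz : (N : ℤ) * (2 * m 1 - m 0) + (6 * m 1 + 3 * m 2 + 2 * m 3 : ℕ) <
      N * (2 * m' 1 - m' 0) + (6 * m' 1 + 3 * m' 2 + 2 * m' 3 : ℕ) := by
    have e0 : (N : ℤ) * (2 * m 1 - m 0) ≤ 0 := by
      have : 0 ≤ (N : ℤ) * m 0 := by positivity
      rw [h0]; push_cast; linarith
    have e1 : (N : ℤ) * 1 ≤ N * (2 * m' 1 - m' 0) := by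
      refine mul_le_mul_of_nonneg_left ?_ (by positivity)
      unfold IsReducedMonomial at hm'
      omega
    omega
  exact_mod_cast hz

variable {k K S : Type*} [Field k] [Field K] [IsAlgClosed K] [CommRing S] [IsDomain S]
  [Algebra K S] {z t : S}

/-- The leading part of a reduced polynomial whose image does not depend on `U`. -/
theorem exists_invariant_top (hzt : IsGenericPair K z t) (ι : k →+* K) {N : ℕ}
    (Ψ : MvPolynomial (Fin 4) k →+* AddMonoidAlgebra S[X] ℚ) {g : Fin 4 → S[X]}
    (hC : ∀ c, (Ψ (MvPolynomial.C c)).HasTop 0 (algebraMap K S[X] (ι c)))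
    (hX : ∀ i, (Ψ (MvPolynomial.X i)).HasTop (russellWeight N i) (g i))
    (h0 : (g 0).coeff 0 = 1) (h1 : (g 1).coeff 0 = -(z ^ 2 + t ^ 3)) (h2 : (g 2).coeff 0 = z)
    (h3 : (g 3).coeff 0 = t)
    {F : MvPolynomial (Fin 4) k} (hF0 : F ≠ 0) (hF : ∀ m ∈ F.support, IsReducedMonomial m)
    (hN : ∀ m ∈ F.support, 6 * m 1 + 3 * m 2 + 2 * m 3 < N)
    (hconst : ∀ e, ((Ψ F).coeff e).natDegree = 0) :
    ((∃ m ∈ F.support, m 1 ≠ 0) → (g 1).natDegree = 0) ∧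
    ((∀ m ∈ F.support, m 0 = 0 → m 2 = 0 → m 3 ≠ 0) →
      (g 0).natDegree = 0 ∨ (g 2).natDegree = 0 ∨ (g 3).natDegree = 0 ∨
        ∃ l : K, l ≠ 0 ∧ (g 2 ^ 2 - C (algebraMap K S l) * g 3 ^ 3).natDegree = 0) := by
  classical
  obtain ⟨μ, hμ, hmax⟩ := F.support.exists_max_image (fun m => ∑ i, m i • russellWeight N i)
    (Finset.nonempty_iff_ne_empty.2 (by simpa using hF0))
  set s := F.support.filter
    (fun m => ∑ i, m i • russellWeight N i = ∑ i, μ i • russellWeight N i) with hs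
  have hμs : μ ∈ s := by simp [hs, MvPolynomial.mem_support_iff.1 hμ]
  have hs' : ∀ m ∈ s, m 0 = μ 0 ∧ m 1 = μ 1 ∧ 3 * m 2 + 2 * m 3 = 3 * μ 2 + 2 * μ 3 := by
    intro m hm
    obtain ⟨hm, hw⟩ := Finset.mem_filter.1 hm
    exact eq_of_russellWeight_eq (hF m hm) (hF μ hμ) (hN m hm) (hN μ hμ) hw
  have htop := (AddMonoidAlgebra.HasTop.map_mvPolynomial Ψ hC hX hmax).2
  rw [← hs] at htop
  set Q := ∑ m ∈ s, algebraMap K S[X] (ι (F.coeff m)) * (g 2 ^ m 2 * g 3 ^ m 3) with hQ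
  have hfac : ∑ m ∈ s, algebraMap K S[X] (ι (F.coeff m)) * ∏ i, g i ^ m i =
      g 0 ^ μ 0 * (g 1 ^ μ 1 * Q) := by
    rw [hQ, Finset.mul_sum, Finset.mul_sum]
    refine Finset.sum_congr rfl fun m hm => ?_
    obtain ⟨e0, e1, -⟩ := hs' m hm
    rw [Fin.prod_univ_four, e0, e1]
    ring
  have hdeg : (g 0 ^ μ 0 * (g 1 ^ μ 1 * Q)).natDegree = 0 := by
    rw [← hfac, ← htop]
    exact hconst _
  have hQ0 : Q.coeff 0 ≠ 0 := by
    have hev : Q.coeff 0 = ∑ m : s, ι (F.coeff m) • (z ^ m.1 2 * t ^ m.1 3) := by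
      rw [coeff_zero_eq_eval_zero] at h2 h3 ⊢
      rw [hQ, eval_finsetSum, Finset.sum_coe_sort s
        (fun m => ι (F.coeff m) • (z ^ m 2 * t ^ m 3))]
      refine Finset.sum_congr rfl fun m _ => ?_
      rw [Algebra.smul_def, Polynomial.algebraMap_apply]
      simp [h2, h3]
    intro hzero
    have hinj : Function.Injective fun m : s => (m.1 2, m.1 3) := by
      intro a b hab
      obtain ⟨a0, a1, -⟩ := hs' _ a.2
      obtain ⟨b0, b1, -⟩ := hs' _ b.2
      obtain ⟨h2, h3⟩ := Prod.ext_iff.1 hab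
      refine Subtype.ext (Finsupp.ext fun i => ?_)
      fin_cases i
      · exact a0.trans b0.symm
      · exact a1.trans b1.symm
      · exact h2
      · exact h3
    have := Fintype.linearIndependent_iff.1 (hzt.linearIndependent.comp _ hinj)
      (fun m => ι (F.coeff m)) (hev ▸ hzero) ⟨μ, hμs⟩
    exact MvPolynomial.mem_support_iff.1 hμ ((map_eq_zero ι).1 this)
  have hg0 : g 0 ≠ 0 := ne_zero_of_coeff_zero_ne_zero (by simp [h0])
  have hg1 : g 1 ≠ 0 :=
    ne_zero_of_coeff_zero_ne_zero (by rw [h1]; exact neg_ne_zero.2 hzt.add_ne_zero)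
  have hQne : Q ≠ 0 := ne_zero_of_coeff_zero_ne_zero hQ0
  have hne : g 0 ^ μ 0 * (g 1 ^ μ 1 * Q) ≠ 0 :=
    mul_ne_zero (pow_ne_zero _ hg0) (mul_ne_zero (pow_ne_zero _ hg1) hQne)
  have hdvd : ∀ {P : S[X]}, P ∣ g 0 ^ μ 0 * (g 1 ^ μ 1 * Q) → P.natDegree = 0 :=
    fun h => natDegree_eq_zero_of_dvd_of_natDegree_eq_zero h hne hdeg
  constructor
  · rintro ⟨m, hm, hm1⟩
    have hμ1 : μ 1 ≠ 0 := fun h =>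
      absurd (hmax m hm) (not_le.2 (russellWeight_lt (hF m hm) (hN μ hμ) h hm1))
    exact hdvd (Dvd.dvd.mul_left (Dvd.dvd.mul_right (dvd_pow_self _ hμ1) _) _)
  · intro hpure
    by_cases hμ0 : μ 0 = 0
    swap
    · exact Or.inl (hdvd (Dvd.dvd.mul_right (dvd_pow_self _ hμ0) _))
    have hM : 3 * μ 2 + 2 * μ 3 ≠ 0 := by
      have := hpure μ hμ hμ0
      omega
    have hQdvd : ∀ {P : S[X]}, P ∣ Q → P.natDegree = 0 :=
      fun h => hdvd (Dvd.dvd.mul_left (Dvd.dvd.mul_left h _) _)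
    rcases exists_factor_of_weighted s (fun m => ι (F.coeff m)) (fun m => m 2) (fun m => m 3) hM
      (fun m hm => (hs' m hm).2.2) (g 2) (g 3) with h | h | ⟨l, hl, h⟩
    · exact Or.inr (Or.inl (hQdvd h))
    · exact Or.inr (Or.inr (Or.inl (hQdvd h)))
    · exact Or.inr (Or.inr (Or.inr ⟨l, hl, hQdvd h⟩))

end TopPart

section Reduction

open MvPolynomial

variable {k R : Type*} [Field k] [CommRing R]

theorem exists_reduced_monomial (ev : MvPolynomial (Fin 4) k →+* R) (h : ev (russellPoly k) = 0)
    (n : ℕ) (m : Fin 4 →₀ ℕ) (hm : m 1 ≤ n) :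
    ∃ F : MvPolynomial (Fin 4) k, ev F = ev (monomial m 1) ∧
      ∀ m' ∈ F.support, IsReducedMonomial m' ∧ m' 1 ≤ n := by
  classical
  by_cases hred : IsReducedMonomial m
  · refine ⟨monomial m 1, rfl, fun m' hm' => ?_⟩
    rw [Finset.mem_singleton.1 (support_monomial_subset hm')]
    exact ⟨hred, hm⟩
  · unfold IsReducedMonomial at hred
    push Not at hred
    induction n generalizing m with
    | zero => exact absurd (Nat.le_zero.1 hm) hred.1
    | succ n ih =>
      have step : ∀ m : Fin 4 →₀ ℕ, m 1 ≤ n →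
          ∃ F : MvPolynomial (Fin 4) k, ev F = ev (monomial m 1) ∧
            ∀ m' ∈ F.support, IsReducedMonomial m' ∧ m' 1 ≤ n + 1 := by
        intro m hm
        by_cases hred : IsReducedMonomial m
        · refine ⟨monomial m 1, rfl, fun m' hm' => ?_⟩
          rw [Finset.mem_singleton.1 (support_monomial_subset hm')]
          exact ⟨hred, by omega⟩
        · unfold IsReducedMonomial at hred
          push Not at hred
          obtain ⟨F, h1, h2⟩ := ih m hm hred
          exact ⟨F, h1, fun m' hm' => ⟨(h2 m' hm').1, (h2 m' hm').2.trans (by omega)⟩⟩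
      set d : Fin 4 →₀ ℕ := Finsupp.single 0 2 + Finsupp.single 1 1 with hd
      have hle : d ≤ m := by
        intro i
        fin_cases i <;> simp [hd] <;> omega
      obtain ⟨r, rfl⟩ := exists_add_of_le hle
      have hr : r 1 ≤ n := by simp [hd] at hm; omega
      obtain ⟨F₀, e₀, h₀⟩ := step (r + Finsupp.single 0 1) (by simpa using hr)
      obtain ⟨F₂, e₂, h₂⟩ := step (r + Finsupp.single 2 2) (by simpa using hr)
      obtain ⟨F₃, e₃, h₃⟩ := step (r + Finsupp.single 3 3) (by simpa using hr)
      refine ⟨-(F₀ + F₂ + F₃), ?_, fun m' hm' => ?_⟩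
      · rw [map_neg, map_add, map_add, e₀, e₂, e₃]
        have e : (monomial (d + r) 1 + (monomial (r + Finsupp.single 0 1) 1 +
            monomial (r + Finsupp.single 2 2) 1 + monomial (r + Finsupp.single 3 3) 1) :
            MvPolynomial (Fin 4) k) = monomial r 1 * russellPoly k := by
          simp only [russellPoly, X_pow_eq_monomial, mul_add, monomial_mul, hd, mul_one]
          simp only [X, monomial_mul, mul_one]
          rw [add_comm (Finsupp.single 0 2 + Finsupp.single 1 1) r]
          ring
        have := congrArg ev e
        rw [map_mul, h, mul_zero, map_add, map_add, map_add] at this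
        linear_combination -this
      · rw [support_neg] at hm'
        rcases Finset.mem_union.1 (support_add hm') with hm' | hm'
        · rcases Finset.mem_union.1 (support_add hm') with hm' | hm'
          · exact h₀ m' hm'
          · exact h₂ m' hm'
        · exact h₃ m' hm'

/-- Reduction modulo `X + X² Y + Z² + T³` does not increase the degree in `Y`. -/
theorem exists_reduced (ev : MvPolynomial (Fin 4) k →+* R) (h : ev (russellPoly k) = 0)
    (F : MvPolynomial (Fin 4) k) :
    ∃ F' : MvPolynomial (Fin 4) k, ev F' = ev F ∧
      ∀ m ∈ F'.support, IsReducedMonomial m ∧ m 1 ≤ F.degreeOf 1 := by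
  classical
  choose! G hG hG' using fun (m : Fin 4 →₀ ℕ) (hm : m 1 ≤ F.degreeOf 1) =>
    exists_reduced_monomial ev h _ m hm
  refine ⟨∑ m ∈ F.support, C (F.coeff m) * G m, ?_, fun m hm => ?_⟩
  · conv_rhs => rw [F.as_sum]
    rw [map_sum, map_sum]
    refine Finset.sum_congr rfl fun m hm => ?_
    rw [map_mul, hG m (monomial_le_degreeOf 1 hm), ← map_mul, C_mul_monomial, mul_one]
  · obtain ⟨m', hm', hmem⟩ := Finset.mem_biUnion.1 (support_sum hm)
    refine hG' m' (monomial_le_degreeOf 1 hm') m ?_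
    rw [C_mul'] at hmem
    exact support_smul hmem

/-- A nonzero reduced polynomial without pure powers of `Y`, representing an element that depends
only on two of the variables. -/
theorem exists_reduced_without_pure (ev : MvPolynomial (Fin 4) k →+* MvPolynomial (Fin 3) k)
    (h : ev (russellPoly k) = 0) (hsurj : Function.Surjective ev) (σ : k →+* k)
    (hσ : ∀ c, ev (C c) = C (σ c)) {a b : Fin 3} (hab : a ≠ b) :
    ∃ F : MvPolynomial (Fin 4) k, F ≠ 0 ∧ (∀ m ∈ F.support, IsReducedMonomial m) ∧
      (∀ m ∈ F.support, m 0 = 0 → m 2 = 0 → m 3 ≠ 0) ∧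
      ev F ∈ Algebra.adjoin k {(X a : MvPolynomial (Fin 3) k), X b} := by
  classical
  obtain ⟨A, hA⟩ := hsurj (X a)
  obtain ⟨B, hB⟩ := hsurj (X b)
  set d := max (A.degreeOf 1) (B.degreeOf 1) with hd
  set M := 2 * d + 2 with hM
  set D := 2 * d * (2 * d + 1) with hD
  choose G hG hG' using fun pq : Fin M × Fin M =>
    exists_reduced ev h (A ^ (pq.1 : ℕ) * B ^ (pq.2 : ℕ))
  have hGD : ∀ pq, ∀ m ∈ (G pq).support, m 1 ≤ D := by
    intro pq m hm
    refine (hG' pq m hm).2.trans ((degreeOf_mul_le _ _ _).trans ?_)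
    have h1 : degreeOf 1 (A ^ (pq.1 : ℕ)) ≤ (2 * d + 1) * d :=
      (degreeOf_pow_le _ _ _).trans (Nat.mul_le_mul (by omega) (le_max_left _ _))
    have h2 : degreeOf 1 (B ^ (pq.2 : ℕ)) ≤ (2 * d + 1) * d :=
      (degreeOf_pow_le _ _ _).trans (Nat.mul_le_mul (by omega) (le_max_right _ _))
    rw [hD]
    nlinarith
  let f : (Fin M × Fin M → k) →ₗ[k] (Fin (D + 1) → k) :=
    { toFun := fun c j => ∑ pq, c pq * (G pq).coeff (Finsupp.single 1 (j : ℕ))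
      map_add' := fun c c' => by
        ext j
        simp [add_mul, Finset.sum_add_distrib]
      map_smul' := fun r c => by
        ext j
        simp [Finset.mul_sum, mul_assoc] }
  have hker : LinearMap.ker f ≠ ⊥ := LinearMap.ker_ne_bot_of_finrank_lt (by
    simp only [Module.finrank_fintype_fun_eq_card, Fintype.card_fin, Fintype.card_prod]
    rw [hM, hD]
    nlinarith)
  obtain ⟨c, hc, hc0⟩ := (Submodule.ne_bot_iff _).1 hker
  have hc' : ∀ j : Fin (D + 1), ∑ pq, c pq * (G pq).coeff (Finsupp.single 1 (j : ℕ)) = 0 :=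
    fun j => congrFun (LinearMap.mem_ker.1 hc) j
  set F : MvPolynomial (Fin 4) k := ∑ pq, C (c pq) * G pq with hF
  have hsupp : ∀ m ∈ F.support, ∃ pq, m ∈ (G pq).support := by
    intro m hm
    obtain ⟨pq, -, hmem⟩ := Finset.mem_biUnion.1 (support_sum hm)
    rw [C_mul'] at hmem
    exact ⟨pq, support_smul hmem⟩
  have hevF : ev F = ∑ pq : Fin M × Fin M, C (σ (c pq)) * (X a ^ (pq.1 : ℕ) * X b ^ (pq.2 : ℕ)) := by
    rw [hF, map_sum]
    refine Finset.sum_congr rfl fun pq _ => ?_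
    rw [map_mul, hσ, hG, map_mul, map_pow, map_pow, hA, hB]
  refine ⟨F, ?_, ?_, ?_, ?_⟩
  · intro h0
    obtain ⟨pq, hpq⟩ := Function.ne_iff.1 hc0
    rw [h0, map_zero] at hevF
    have := congrArg (coeff (Finsupp.single a (pq.1 : ℕ) + Finsupp.single b (pq.2 : ℕ))) hevF
    rw [coeff_zero, coeff_sum, Finset.sum_eq_single pq] at this
    · rw [coeff_C_mul, X_pow_eq_monomial, X_pow_eq_monomial, monomial_mul, coeff_monomial,
        if_pos rfl, one_mul, mul_one] at this
      exact hpq ((map_eq_zero σ).1 this.symm)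
    · intro pq' _ hne
      rw [coeff_C_mul, X_pow_eq_monomial, X_pow_eq_monomial, monomial_mul, coeff_monomial,
        if_neg, mul_zero]
      intro heq
      refine hne (Prod.ext (Fin.ext ?_) (Fin.ext ?_))
      · simpa [hab] using DFunLike.congr_fun heq a
      · simpa [hab] using DFunLike.congr_fun heq b
    · simp
  · intro m hm
    obtain ⟨pq, hpq⟩ := hsupp m hm
    exact (hG' pq m hpq).1
  · intro m hm h0 h2 h3
    obtain ⟨pq, hpq⟩ := hsupp m hm
    have hmD := hGD pq m hpq
    have hms : m = Finsupp.single 1 (m 1) := by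
      ext i
      fin_cases i <;> simp [h0, h2, h3]
    refine mem_support_iff.1 hm ?_
    rw [hF, coeff_sum, ← hc' ⟨m 1, by omega⟩]
    refine Finset.sum_congr rfl fun pq _ => ?_
    rw [coeff_C_mul, ← hms]
  · rw [hevF]
    refine Subalgebra.sum_mem _ fun pq _ => Subalgebra.mul_mem _ ?_ (Subalgebra.mul_mem _ ?_ ?_)
    · exact Subalgebra.algebraMap_mem _ _
    · exact Subalgebra.pow_mem _ (Algebra.subset_adjoin (by simp)) _
    · exact Subalgebra.pow_mem _ (Algebra.subset_adjoin (by simp)) _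

/-- A variable that is not a polynomial in `x`, `z`, `t`. -/
theorem exists_variable_not_mem (ev : MvPolynomial (Fin 4) k →+* MvPolynomial (Fin 3) k)
    (hker : ∀ F, ev F = 0 → F ∈ Ideal.span {russellPoly k}) (hsurj : Function.Surjective ev) :
    ∃ a : Fin 3, ∀ F : MvPolynomial (Fin 4) k, ev F = X a → ∃ m ∈ F.support, m 1 ≠ 0 := by
  obtain ⟨q, hqC, hqX⟩ : ∃ q : MvPolynomial (Fin 4) k →+* Polynomial k,
      (∀ c, q (C c) = Polynomial.C c) ∧
        ∀ i, q (X i) = (![0, Polynomial.X, 0, 0] : Fin 4 → Polynomial k) i :=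
    ⟨eval₂Hom Polynomial.C ![0, Polynomial.X, 0, 0], eval₂Hom_C _ _, eval₂Hom_X' _ _⟩
  have hq : q (russellPoly k) = 0 := by simp [russellPoly, hqX]
  have hker' : RingHom.ker ev ≤ RingHom.ker q := by
    intro F hF
    refine (Ideal.span_singleton_le_iff_mem _).2 ?_ (hker F hF)
    exact hq
  obtain ⟨lam, hlam⟩ : ∃ lam : MvPolynomial (Fin 3) k →+* Polynomial k,
      ∀ F, lam (ev F) = q F :=
    ⟨RingHom.liftOfRightInverse ev (Function.surjInv hsurj) (Function.rightInverse_surjInv hsurj)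
      ⟨q, hker'⟩, fun F => RingHom.liftOfRightInverse_comp_apply ev _
        (Function.rightInverse_surjInv hsurj) ⟨q, hker'⟩ F⟩
  by_contra! hcon
  have hvar : ∀ a : Fin 3, (lam (X a)).natDegree = 0 := by
    intro a
    obtain ⟨F, hF, hF'⟩ := hcon a
    have hm : ∀ m ∈ F.support, q (monomial m (F.coeff m)) =
        Polynomial.C (F.coeff m * (0 ^ m 0 * 0 ^ m 2 * 0 ^ m 3)) := by
      intro m hm
      rw [monomial_eq, map_mul, hqC, Finsupp.prod_fintype _ _ (by simp), Fin.prod_univ_four]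
      simp [hqX, hF' m hm]
    rw [← hF, hlam, F.as_sum, map_sum, Finset.sum_congr rfl hm, ← map_sum,
      Polynomial.natDegree_C]
  have hall : ∀ p, (lam p).natDegree = 0 := by
    intro p
    induction p using MvPolynomial.induction_on with
    | C c =>
      by_cases hc : c = 0
      · simp [hc]
      · exact Polynomial.natDegree_eq_zero_of_isUnit (((Ne.isUnit hc).map C).map lam)
    | add p p' hp hp' =>
      obtain ⟨c, hc⟩ := Polynomial.natDegree_eq_zero.1 hp
      obtain ⟨c', hc'⟩ := Polynomial.natDegree_eq_zero.1 hp'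
      rw [map_add, ← hc, ← hc', ← map_add, Polynomial.natDegree_C]
    | mul_X p i hp =>
      obtain ⟨c, hc⟩ := Polynomial.natDegree_eq_zero.1 hp
      obtain ⟨c', hc'⟩ := Polynomial.natDegree_eq_zero.1 (hvar i)
      rw [map_mul, ← hc, ← hc', ← map_mul, Polynomial.natDegree_C]
  have := hall (ev (X 1))
  rw [hlam, hqX] at this
  simp at this

end Reduction

section Twist

open Polynomial

/-- The weight of `U` that makes the homomorphism `Φ` homogeneous to leading order. -/
theorem exists_weight {ι S : Type*} [Fintype ι] [CommRing S] (H : ι → (AddMonoidAlgebra S ℚ)[X])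
    (w : ι → ℚ) (hH : ∃ i, (H i).natDegree ≠ 0) :
    ∃ ρ : ℚ, (∀ i j e, j ≠ 0 → ((H i).coeff j).coeff e ≠ 0 → j * ρ ≤ w i - e) ∧
      ∃ i j e, j ≠ 0 ∧ ((H i).coeff j).coeff e ≠ 0 ∧ j * ρ = w i - e := by
  classical
  set s : Finset (ι × ℕ × ℚ) := Finset.univ.biUnion fun i =>
    ((H i).support.filter (· ≠ 0)).biUnion fun j =>
      ((H i).coeff j).coeff.support.image fun e => (i, j, e) with hs
  have hmem : ∀ i j e, (i, j, e) ∈ s ↔ j ≠ 0 ∧ ((H i).coeff j).coeff e ≠ 0 := by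
    intro i j e
    simp only [hs, Finset.mem_biUnion, Finset.mem_univ, true_and, Finset.mem_filter,
      mem_support_iff, Finset.mem_image, Finsupp.mem_support_iff, Prod.mk.injEq]
    constructor
    · rintro ⟨i', j', ⟨h1, h2⟩, e', h3, rfl, rfl, rfl⟩
      exact ⟨h2, h3⟩
    · rintro ⟨h1, h2⟩
      exact ⟨i, j, ⟨fun h => h2 (by simp [h]), h1⟩, e, h2, rfl, rfl, rfl⟩
  have hne : s.Nonempty := by
    obtain ⟨i, hi⟩ := hH
    have h0 : (H i).coeff (H i).natDegree ≠ 0 := by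
      rw [coeff_natDegree, leadingCoeff_ne_zero]
      rintro h
      simp [h] at hi
    obtain ⟨e, he⟩ : ∃ e, ((H i).coeff (H i).natDegree).coeff e ≠ 0 := by
      by_contra! hcon
      exact h0 (by ext e; simpa using hcon e)
    exact ⟨(i, _, e), (hmem _ _ _).2 ⟨hi, he⟩⟩
  obtain ⟨⟨i, j, e⟩, hin, hmin⟩ := s.exists_min_image (fun x => (w x.1 - x.2.2) / x.2.1) hne
  obtain ⟨hj, he⟩ := (hmem _ _ _).1 hin
  refine ⟨(w i - e) / j, fun i' j' e' hj' he' => ?_, i, j, e, hj, he, ?_⟩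
  · have := hmin (i', j', e') ((hmem _ _ _).2 ⟨hj', he'⟩)
    have hpos : (0 : ℚ) < j' := by exact_mod_cast Nat.pos_of_ne_zero hj'
    rw [le_div_iff₀ hpos] at this
    linarith
  · have hpos : (j : ℚ) ≠ 0 := by exact_mod_cast hj
    field_simp

theorem hasTop_weightTwist {S : Type*} [CommRing S] {H : (AddMonoidAlgebra S ℚ)[X]} {w ρ : ℚ}
    {a : S} (h0 : (H.coeff 0).HasTop w a)
    (hρ : ∀ j e, j ≠ 0 → (H.coeff j).coeff e ≠ 0 → j * ρ ≤ w - e) :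
    (weightTwist S ρ H).HasTop w ((weightTwist S ρ H).coeff w) ∧
      ((weightTwist S ρ H).coeff w).coeff 0 = a := by
  refine ⟨⟨fun e he => ?_, rfl⟩, ?_⟩
  · ext j
    rw [coeff_coeff_weightTwist, coeff_zero]
    by_cases hj : j = 0
    · subst hj
      simpa using h0.1 e he
    · by_contra hne
      have := hρ j _ hj hne
      linarith
  · rw [coeff_coeff_weightTwist]
    simpa using h0.2

end Twist

section Main

open MvPolynomial
open AddMonoidAlgebra (single)

/-- A family of homomorphisms from the coordinate ring of the Russell cubic, which spreads out the
weights of the coordinates. -/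
theorem exists_spreading {k K S : Type*} [Field k] [Field K] [CommRing S] [Algebra K S]
    (ι : k →+* K) (z t : S) (N : ℕ) :
    ∃ θ : MvPolynomial (Fin 4) k →+* AddMonoidAlgebra S ℚ, θ (russellPoly k) = 0 ∧
      (∀ c, θ (C c) = single 0 (algebraMap K S (ι c))) ∧
      ∀ i, (θ (X i)).HasTop (russellWeight N i) ((![1, -(z ^ 2 + t ^ 3), z, t] : Fin 4 → S) i) := by
  let v : Fin 4 → AddMonoidAlgebra S ℚ := ![single (-N : ℚ) (1 : S),
    single (6 + 2 * N : ℚ) (-(z ^ 2 + t ^ 3)) + single (N : ℚ) (-1 : S), single (3 : ℚ) z,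
    single (2 : ℚ) t]
  refine ⟨eval₂Hom ((AddMonoidAlgebra.singleZeroRingHom.comp (algebraMap K S)).comp ι) v,
    ?_, fun c => by simp, fun i => ?_⟩
  · simp only [russellPoly, map_add, map_mul, map_pow, eval₂Hom_X', v]
    simp only [Matrix.cons_val, AddMonoidAlgebra.single_pow, mul_add,
      AddMonoidAlgebra.single_mul_single]
    have e1 : (2 • (-N : ℚ) + (6 + 2 * N)) = 6 := by rw [two_nsmul]; ring
    have e2 : (2 • (-N : ℚ) + N) = -N := by rw [two_nsmul]; ring
    have e3 : (2 • (3 : ℚ)) = 6 := by norm_num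
    have e4 : (3 • (2 : ℚ)) = 6 := by norm_num
    rw [e1, e2, e3, e4]
    ext e
    simp only [AddMonoidAlgebra.coeff_add, AddMonoidAlgebra.coeff_single, Finsupp.add_apply,
      Finsupp.single_apply]
    split_ifs <;> simp
  · rw [eval₂Hom_X']
    fin_cases i
    · exact .single
    · have h : (single (N : ℚ) (-1) : AddMonoidAlgebra S ℚ).HasTop (6 + 2 * N) 0 :=
        AddMonoidAlgebra.HasTop.single.of_lt (by
          have : (0 : ℚ) ≤ N := by positivity
          linarith)
      have h' := (AddMonoidAlgebra.HasTop.single (n := (6 + 2 * N : ℚ))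
        (a := -(z ^ 2 + t ^ 3))).add h
      rw [add_zero] at h'
      exact h'
    · exact .single
    · exact .single

theorem relation_of_hasTop {k A : Type*} [Field k] [CommRing A] {N : ℕ}
    (Ψ : MvPolynomial (Fin 4) k →+* AddMonoidAlgebra A ℚ) (h : Ψ (russellPoly k) = 0)
    {g : Fin 4 → A} (hX : ∀ i, (Ψ (X i)).HasTop (russellWeight N i) (g i)) :
    g 0 ^ 2 * g 1 + g 2 ^ 2 + g 3 ^ 3 = 0 := by
  have h0 : (Ψ (X 0)).HasTop 6 0 := (hX 0).of_lt (by
    have : (0 : ℚ) ≤ N := by positivity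
    simp only [russellWeight, Matrix.cons_val]
    linarith)
  have h1 : (Ψ (X 0) ^ 2 * Ψ (X 1)).HasTop 6 (g 0 ^ 2 * g 1) := by
    have e : 2 • russellWeight N 0 + russellWeight N 1 = 6 := by
      simp only [russellWeight, Matrix.cons_val]
      rw [two_nsmul]
      ring
    exact e ▸ ((hX 0).pow 2).mul (hX 1)
  have h2 : (Ψ (X 2) ^ 2).HasTop 6 (g 2 ^ 2) := by
    have e : 2 • russellWeight N 2 = 6 := by
      simp only [russellWeight, Matrix.cons_val]
      norm_num
    exact e ▸ (hX 2).pow 2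
  have h3 : (Ψ (X 3) ^ 3).HasTop 6 (g 3 ^ 3) := by
    have e : 3 • russellWeight N 3 = 6 := by
      simp only [russellWeight, Matrix.cons_val]
      norm_num
    exact e ▸ (hX 3).pow 3
  have := ((h0.add h1).add h2).add h3
  rw [zero_add, ← map_pow, ← map_pow, ← map_pow, ← map_mul, ← map_add, ← map_add, ← map_add] at this
  exact this.unique (show (Ψ (russellPoly k)).HasTop 6 0 by rw [h]; exact .zero)

theorem mainTheorem2 (k : Type*) [Field k] :
    IsEmpty (RussellRing k ≃+* MvPolynomial (Fin 3) k) := by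
  constructor
  intro e
  set ev : MvPolynomial (Fin 4) k →+* MvPolynomial (Fin 3) k :=
    (e : RussellRing k →+* MvPolynomial (Fin 3) k).comp (Ideal.Quotient.mk _) with hev
  have hsurj : Function.Surjective ev := e.surjective.comp Ideal.Quotient.mk_surjective
  have hker : ∀ F, ev F = 0 → F ∈ Ideal.span {russellPoly k} := fun F hF =>
    Ideal.Quotient.eq_zero_iff_mem.1 (e.map_eq_zero_iff.1 hF)
  have hrus : ev (russellPoly k) = 0 := by
    rw [hev, RingHom.comp_apply, Ideal.Quotient.eq_zero_iff_mem.2 (Ideal.mem_span_singleton_self _),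
      map_zero]
  clear_value ev
  obtain ⟨σ, hσ⟩ : ∃ σ : k →+* k, ∀ c, ev (C c) = C (σ c) := by
    refine ⟨constantCoeff.comp (ev.comp C), fun c => ?_⟩
    by_cases hc : c = 0
    · simp [hc]
    · obtain ⟨r, -, hr⟩ :=
        isUnit_iff_eq_C_of_isReduced.1 (((Ne.isUnit hc).map C).map ev)
      simp [hr]
  obtain ⟨a, ha⟩ := exists_variable_not_mem ev hker hsurj
  obtain ⟨s, b, hsa, hsb, hab⟩ : ∃ s b : Fin 3, a ≠ s ∧ b ≠ s ∧ a ≠ b :=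
    ⟨a + 1, a + 2, by clear ha; revert a; decide, by clear ha; revert a; decide, by clear ha; revert a; decide⟩
  obtain ⟨A, hA⟩ := hsurj (X a)
  obtain ⟨F₁, hF₁, hF₁red⟩ := exists_reduced ev hrus A
  obtain ⟨F₂, hF₂, hF₂red, hF₂pure, hF₂adj⟩ := exists_reduced_without_pure ev hrus hsurj σ hσ hab
  rw [hA] at hF₁
  obtain ⟨N, hN⟩ : ∃ N : ℕ, ∀ m ∈ F₁.support ∪ F₂.support, 6 * m 1 + 3 * m 2 + 2 * m 3 < N :=
    ⟨_, fun m hm => Nat.lt_succ_of_le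
      (Finset.le_sup (f := fun m : Fin 4 →₀ ℕ => 6 * m 1 + 3 * m 2 + 2 * m 3) hm)⟩
  obtain ⟨K, _, _, ι⟩ : ∃ (K : Type _) (_ : Field K) (_ : IsAlgClosed K), Nonempty (k →+* K) :=
    ⟨AlgebraicClosure k, inferInstance, inferInstance, ⟨algebraMap _ _⟩⟩
  obtain ⟨ι⟩ := ι
  obtain ⟨S, _, _, _, z, t, hzt⟩ : ∃ (S : Type _) (_ : CommRing S) (_ : IsDomain S)
      (_ : Algebra K S) (z t : S), IsGenericPair K z t :=
    ⟨_, inferInstance, inferInstance, inferInstance, _, _, isGenericPair_C_X_X K⟩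
  obtain ⟨θ₀, hθrus, hθC, hθX⟩ := exists_spreading ι z t N
  obtain ⟨θ, hθ⟩ : ∃ θ : MvPolynomial (Fin 3) k →+* AddMonoidAlgebra S ℚ,
      ∀ F, θ (ev F) = θ₀ F := by
    have hle : RingHom.ker ev ≤ RingHom.ker θ₀ := by
      intro F hF
      refine (Ideal.span_singleton_le_iff_mem _).2 ?_ (hker F hF)
      exact hθrus
    exact ⟨RingHom.liftOfRightInverse ev (Function.surjInv hsurj)
      (Function.rightInverse_surjInv hsurj) ⟨θ₀, hle⟩, fun F =>
        RingHom.liftOfRightInverse_comp_apply ev _ (Function.rightInverse_surjInv hsurj)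
          ⟨θ₀, hle⟩ F⟩
  obtain ⟨Φ, hΦC, hΦX⟩ : ∃ Φ : MvPolynomial (Fin 3) k →+* Polynomial (AddMonoidAlgebra S ℚ),
      (∀ c, Φ (C c) = Polynomial.C (θ (C c))) ∧
        ∀ i, Φ (X i) = Polynomial.C (θ (X i)) + if i = s then Polynomial.X else 0 :=
    ⟨eval₂Hom ((Polynomial.C.comp θ).comp C)
      (fun i => Polynomial.C (θ (X i)) + if i = s then Polynomial.X else 0),
      fun c => eval₂Hom_C _ _ _, fun i => eval₂Hom_X' _ _ i⟩
  have hΦ0 : ∀ p, (Φ p).coeff 0 = θ p := by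
    have : (Polynomial.constantCoeff.comp Φ) = θ := by
      refine MvPolynomial.ringHom_ext (fun c => by simp [hΦC]) fun i => ?_
      by_cases hi : i = s <;> simp [hΦX, hi]
    exact fun p => RingHom.congr_fun this p
  have hΦadj : ∀ p ∈ Algebra.adjoin k {(X a : MvPolynomial (Fin 3) k), X b},
      Φ p = Polynomial.C (θ p) := by
    intro p hp
    induction hp using Algebra.adjoin_induction with
    | mem x hx =>
      rcases hx with rfl | rfl
      · simp [hΦX, hsa]
      · simp [hΦX, hsb]
    | algebraMap c => exact hΦC c
    | add x y _ _ hx hy => simp [hx, hy]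
    | mul x y _ _ hx hy => simp [hx, hy]
  have hΦev : ∀ c, Φ (ev (C c)) = Polynomial.C (single 0 (algebraMap K S (ι c))) := by
    intro c
    rw [hσ, hΦC, ← hσ, hθ, hθC]
  have hnontriv : ∃ i : Fin 4, (Φ (ev (X i))).natDegree ≠ 0 := by
    by_contra! hcon
    have : Φ.comp ev = (Polynomial.C.comp θ).comp ev := by
      refine MvPolynomial.ringHom_ext (fun c => ?_) fun i => ?_
      · simp [hΦev, hθ, hθC]
      · have := Polynomial.eq_C_of_natDegree_eq_zero (hcon i)
        rw [hΦ0] at this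
        exact this
    obtain ⟨B, hB⟩ := hsurj (X s)
    have h1 := congrArg (fun p => Polynomial.coeff p 1) (RingHom.congr_fun this B)
    simp [hB, hΦX] at h1
  obtain ⟨ρ, hρ, i₀, j₀, e₀, hj₀, hne₀, heq₀⟩ :=
    exists_weight (fun i => Φ (ev (X i))) (russellWeight N) hnontriv
  have htw := fun i => hasTop_weightTwist (ρ := ρ) (H := Φ (ev (X i))) (w := russellWeight N i)
    (by rw [hΦ0, hθ]; exact hθX i) (hρ i)
  set Ψ : MvPolynomial (Fin 4) k →+* AddMonoidAlgebra (Polynomial S) ℚ :=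
    ((weightTwist S ρ).comp Φ).comp ev with hΨ
  set g : Fin 4 → Polynomial S :=
    fun i => (weightTwist S ρ (Φ (ev (X i)))).coeff (russellWeight N i) with hg
  have hgX : ∀ i, (Ψ (X i)).HasTop (russellWeight N i) (g i) := fun i => (htw i).1
  have hΨC : ∀ c, (Ψ (C c)).HasTop 0 (algebraMap K (Polynomial S) (ι c)) := by
    intro c
    have : Ψ (C c) = single 0 (algebraMap K (Polynomial S) (ι c)) := by
      rw [hΨ, RingHom.comp_apply, RingHom.comp_apply, hΦev, Polynomial.algebraMap_apply]
      simp [weightTwist]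
    rw [this]
    exact .single
  have hΨconst : ∀ F, ev F ∈ Algebra.adjoin k {(X a : MvPolynomial (Fin 3) k), X b} →
      ∀ e, ((Ψ F).coeff e).natDegree = 0 := by
    intro F hF e
    refine Nat.le_zero.1 (Polynomial.natDegree_le_iff_coeff_eq_zero.2 fun j hj => ?_)
    rw [hΨ, RingHom.comp_apply, RingHom.comp_apply, hΦadj _ hF, coeff_coeff_weightTwist,
      Polynomial.coeff_C_of_ne_zero (by omega)]
    rfl
  have hrel := relation_of_hasTop Ψ (by simp [hΨ, hrus]) hgX
  have h0 : (g 0).coeff 0 = 1 := (htw 0).2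
  have h1 : (g 1).coeff 0 = -(z ^ 2 + t ^ 3) := (htw 1).2
  have h2 : (g 2).coeff 0 = z := (htw 2).2
  have h3 : (g 3).coeff 0 = t := (htw 3).2
  obtain ⟨m₁, hm₁, hm₁'⟩ := ha F₁ hF₁
  have hF₁0 : F₁ ≠ 0 := by
    rintro rfl
    simp at hm₁
  have hY : (g 1).natDegree = 0 :=
    (exists_invariant_top hzt ι Ψ hΨC hgX h0 h1 h2 h3 hF₁0 (fun m hm => (hF₁red m hm).1)
      (fun m hm => hN m (Finset.mem_union_left _ hm))
      (hΨconst F₁ (by rw [hF₁]; exact Algebra.subset_adjoin (by simp)))).1 ⟨m₁, hm₁, hm₁'⟩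
  have hcase := (exists_invariant_top hzt ι Ψ hΨC hgX h0 h1 h2 h3 hF₂ hF₂red
    (fun m hm => hN m (Finset.mem_union_right _ hm)) (hΨconst F₂ hF₂adj)).2 hF₂pure
  obtain ⟨d0, d2, d3⟩ := natDegree_eq_zero_of_relation hzt hrel h0 h1 h2 h3 hY hcase
  have hdeg : ∀ i, (g i).natDegree = 0 := by
    intro i
    fin_cases i
    exacts [d0, hY, d2, d3]
  have hcoef : (g i₀).coeff j₀ ≠ 0 := by
    rw [hg, coeff_coeff_weightTwist, heq₀, sub_sub_cancel]
    exact hne₀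
  exact hcoef (Polynomial.coeff_eq_zero_of_natDegree_lt (by rw [hdeg]; omega))

end Main
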